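/- All semigroups are finite and nonempty. Let $\mathbf 2^r$ and $\mathbf 2^l$ be the two-element right zero and left zero semigroups and $\{0,1\}$ the two-element semilattice under multiplication. A finite semigroup $T$ is *projective* if every surjective homomorphism $\varphi\colon S\to T$ from a finite semigroup $S$ splits, i.e. there is a homomorphism $\psi\colon T\to S$ with $\varphi(\psi(t))=t$ for all $t\in T$. $\mathbf{PV}$ is the lattice of pseudovarieties of finite semigroups (classes closed under finite products, subsemigroups and homomorphic images), ordered by inclusion; $(T)$ is the pseudovariety generated by $T$. A *relational morphism* $f\colon S\to T$ assigns to each $s\in S$ a nonempty subset $sf\subseteq T$ with $s_1f\cdot s_2f\subseteq (s_1s_2)f$; it is a *division* if $sf\cap s'f=\emptyset$ for $s\neq s'$. A *pseudovariety of relational morphisms* is a class of relational morphisms between finite semigroups that contains the identity map of the trivial semigroup and is closed under finite direct products, composition with divisions on either side, passing to a relational morphism $f\subseteq g$ with the same domain and codomain as a member $g$, and corestriction (if $f\colon S\to T'$ is a member and $sf\subseteq T\leq T'$ for all $s\in S$, then $f\colon S\to T$ is a member). These classes, ordered by inclusion, form the complete lattice $\mathbf{PVRM}$; $(f)$ is the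 member of $\mathbf{PVRM}$ generated by $f$, and $1_a$ is the identity map of $a$. An *atom* is a minimal element of a lattice minus its bottom. **Theorem.** (a) If $a$ is $\mathbf 2^r$, $\mathbf 2^l$ or $\{0,1\}$, then $a$ is projective, $(a)$ is an atom of $\mathbf{PV}$, and $(1_a)$ is an atom of $\mathbf{PVRM}$. (b) These are, up to generating the same pseudovariety, the only projective atoms of $\mathbf{PV}$: if $a$ is a projective finite semigroup such that $(a)$ is an atom of $\mathbf{PV}$, then $(a)$ is one of $(\mathbf 2^r)$, $(\mathbf 2^l)$, $(\{0,1\})$; and for every such $a$, $(1_a)$ is an atom of $\mathbf{PVRM}$. -/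

import Mathlib

universe u

/-- Finite (nonempty) semigroups. -/
structure FinSgp : Type (u + 1) where
  carrier : Type u
  [semigroup : Semigroup carrier]
  [finite : Finite carrier]
  [nonempty : Nonempty carrier]

namespace FinSgp

instance : CoeSort FinSgp.{u} (Type u) := ⟨FinSgp.carrier⟩

instance (S : FinSgp.{u}) : Semigroup S := S.semigroup
instance (S : FinSgp.{u}) : Finite S := S.finite
instance (S : FinSgp.{u}) : Nonempty S := S.nonempty

/-- The one-element semigroup. -/
def trivial : FinSgp.{u} where
  carrier := PUnit.{u + 1}

/-- The direct product of two finite semigroups. -/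
def prod (S T : FinSgp.{u}) : FinSgp.{u} where
  carrier := S × T

/-- The two-element right zero semigroup `2^r`. -/
def twoRightZero : FinSgp.{u} where
  carrier := ULift.{u} (Fin 2)
  semigroup := { mul := fun _ y => y, mul_assoc := fun _ _ _ => rfl }

/-- The two-element left zero semigroup `2^l`. -/
def twoLeftZero : FinSgp.{u} where
  carrier := ULift.{u} (Fin 2)
  semigroup := { mul := fun x _ => x, mul_assoc := fun _ _ _ => rfl }

/-- The two-element semilattice `{0, 1}` under multiplication. -/
def zeroOne : FinSgp.{u} where
  carrier := ULift.{u} (Fin 2)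
  semigroup :=
    { mul := fun x y => ⟨x.down * y.down⟩
      mul_assoc := fun x y z => congrArg ULift.up (mul_assoc x.down y.down z.down) }

/-- A finite semigroup is projective if every surjective homomorphism onto it from a finite
semigroup splits. -/
def IsProjective (T : FinSgp.{u}) : Prop :=
  ∀ (S : FinSgp.{u}) (φ : S →ₙ* T), Function.Surjective φ →
    ∃ ψ : T →ₙ* S, ∀ t : T, φ (ψ t) = t

end FinSgp

/-- Pseudovarieties of finite semigroups: classes of finite semigroups that are closed under
finite direct products, subsemigroups and homomorphic images. -/
@[ext]
structure PV : Type (u + 1) where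
  carrier : Set FinSgp.{u}
  trivial_mem : FinSgp.trivial ∈ carrier
  prod_mem : ∀ S T : FinSgp.{u}, S ∈ carrier → T ∈ carrier → S.prod T ∈ carrier
  sub_mem : ∀ (S T : FinSgp.{u}) (j : S →ₙ* T), Function.Injective j →
    T ∈ carrier → S ∈ carrier
  quot_mem : ∀ (S T : FinSgp.{u}) (p : S →ₙ* T), Function.Surjective p →
    S ∈ carrier → T ∈ carrier

namespace PV

instance : SetLike PV.{u} FinSgp.{u} where
  coe := PV.carrier
  coe_injective _ _ h := PV.ext h

/-- Pseudovarieties are ordered by inclusion. -/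
instance : PartialOrder PV.{u} := PartialOrder.ofSetLike PV.{u} FinSgp.{u}

instance : InfSet PV.{u} where
  sInf X :=
    { carrier := {S | ∀ V ∈ X, S ∈ V}
      trivial_mem := fun V _ => V.trivial_mem
      prod_mem := fun S T hS hT V hV => V.prod_mem S T (hS V hV) (hT V hV)
      sub_mem := fun S T j hj hT V hV => V.sub_mem S T j hj (hT V hV)
      quot_mem := fun S T p hp hS V hV => V.quot_mem S T p hp (hS V hV) }

instance : CompleteLattice PV.{u} :=
  completeLatticeOfInf PV.{u} fun _ =>
    ⟨fun V hV _ hS => hS V hV, fun _ hW _ hS _ hV => hW hV hS⟩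

/-- The pseudovariety generated by a class of finite semigroups. -/
def generate (X : Set FinSgp.{u}) : PV.{u} := sInf {V | X ⊆ (V : Set FinSgp.{u})}

end PV

/-- A relational morphism `S → T`: every `s` is related to a nonempty set of elements of `T`, and
`(s₁ f) (s₂ f) ⊆ (s₁ s₂) f`. -/
@[ext]
structure RelMor (S T : FinSgp.{u}) : Type u where
  rel : S → Set T
  nonempty' : ∀ s : S, (rel s).Nonempty
  mul_mem' : ∀ (s₁ s₂ : S) (t₁ t₂ : T), t₁ ∈ rel s₁ → t₂ ∈ rel s₂ → t₁ * t₂ ∈ rel (s₁ * s₂)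

namespace RelMor

/-- A homomorphism, viewed as a relational morphism. -/
def ofHom {S T : FinSgp.{u}} (φ : S →ₙ* T) : RelMor S T where
  rel s := {φ s}
  nonempty' s := ⟨φ s, rfl⟩
  mul_mem' := by
    rintro s₁ s₂ _ _ rfl rfl
    exact (map_mul φ s₁ s₂).symm

/-- The identity map `1_S`. -/
def id (S : FinSgp.{u}) : RelMor S S := ofHom (MulHom.id S)

/-- The composite `S → T → U` (first `f`, then `g`). -/
def comp {S T U : FinSgp.{u}} (f : RelMor S T) (g : RelMor T U) : RelMor S U where
  rel s := {x | ∃ t ∈ f.rel s, x ∈ g.rel t}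
  nonempty' s := by
    obtain ⟨t, ht⟩ := f.nonempty' s
    obtain ⟨x, hx⟩ := g.nonempty' t
    exact ⟨x, t, ht, hx⟩
  mul_mem' := by
    rintro s₁ s₂ x₁ x₂ ⟨t₁, ht₁, hx₁⟩ ⟨t₂, ht₂, hx₂⟩
    exact ⟨t₁ * t₂, f.mul_mem' _ _ _ _ ht₁ ht₂, g.mul_mem' _ _ _ _ hx₁ hx₂⟩

/-- The product `f × g : S × S' → T × T'`. -/
def prod {S T S' T' : FinSgp.{u}} (f : RelMor S T) (g : RelMor S' T') :
    RelMor (S.prod S') (T.prod T') where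
  rel s := {t | t.1 ∈ f.rel s.1 ∧ t.2 ∈ g.rel s.2}
  nonempty' s := by
    obtain ⟨t, ht⟩ := f.nonempty' s.1
    obtain ⟨t', ht'⟩ := g.nonempty' s.2
    exact ⟨(t, t'), ht, ht'⟩
  mul_mem' := fun _ _ _ _ h₁ h₂ =>
    ⟨f.mul_mem' _ _ _ _ h₁.1 h₂.1, g.mul_mem' _ _ _ _ h₁.2 h₂.2⟩

/-- A division is an injective relational morphism: distinct elements are related to disjoint
sets. -/
def IsDivision {S T : FinSgp.{u}} (d : RelMor S T) : Prop :=
  ∀ (s s' : S) (t : T), t ∈ d.rel s → t ∈ d.rel s' → s = s'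

end RelMor

/-- All relational morphisms between finite semigroups. -/
abbrev FinRelMor : Type (u + 1) := Σ S T : FinSgp.{u}, RelMor S T

/-- A relational morphism, together with its domain and codomain. -/
def RelMor.bundle {S T : FinSgp.{u}} (f : RelMor S T) : FinRelMor.{u} := ⟨S, T, f⟩

/-- Pseudovarieties of relational morphisms: classes of relational morphisms between finite
semigroups that contain the identity of the trivial semigroup and are closed under finite products,
composition with divisions on both sides (which includes restriction of the domain, range extension
and passing to isomorphic copies), passing to a relational morphism with the same domain and
codomain contained in a given one, and corestriction. -/
@[ext]
structure PVRM : Type (u + 1) where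
  carrier : Set FinRelMor.{u}
  id_trivial_mem : (RelMor.id FinSgp.trivial).bundle ∈ carrier
  prod_mem : ∀ {S T S' T' : FinSgp.{u}} (f : RelMor S T) (g : RelMor S' T'),
    f.bundle ∈ carrier → g.bundle ∈ carrier → (f.prod g).bundle ∈ carrier
  div_comp_mem : ∀ {S' S T : FinSgp.{u}} (d : RelMor S' S) (f : RelMor S T),
    d.IsDivision → f.bundle ∈ carrier → (d.comp f).bundle ∈ carrier
  comp_div_mem : ∀ {S T T' : FinSgp.{u}} (f : RelMor S T) (d : RelMor T T'),
    d.IsDivision → f.bundle ∈ carrier → (f.comp d).bundle ∈ carrier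
  mono_mem : ∀ {S T : FinSgp.{u}} (f g : RelMor S T),
    (∀ s, f.rel s ⊆ g.rel s) → g.bundle ∈ carrier → f.bundle ∈ carrier
  /-- If the range of a member lies in a subsemigroup `T` of its codomain (`j` is the inclusion),
  then the corestriction to `T` is a member. -/
  corestrict_mem : ∀ {S T T' : FinSgp.{u}} (f : RelMor S T) (j : T →ₙ* T'),
    Function.Injective j → (f.comp (RelMor.ofHom j)).bundle ∈ carrier → f.bundle ∈ carrier

namespace PVRM

instance : SetLike PVRM.{u} FinRelMor.{u} where
  coe := PVRM.carrier
  coe_injective _ _ h := PVRM.ext h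

/-- Pseudovarieties of relational morphisms are ordered by inclusion. -/
instance : PartialOrder PVRM.{u} := PartialOrder.ofSetLike PVRM.{u} FinRelMor.{u}

instance : InfSet PVRM.{u} where
  sInf X :=
    { carrier := {f | ∀ R ∈ X, f ∈ R}
      id_trivial_mem := fun R _ => R.id_trivial_mem
      prod_mem := fun f g hf hg R hR => R.prod_mem f g (hf R hR) (hg R hR)
      div_comp_mem := fun d f hd hf R hR => R.div_comp_mem d f hd (hf R hR)
      comp_div_mem := fun f d hd hf R hR => R.comp_div_mem f d hd (hf R hR)
      mono_mem := fun f g h hg R hR => R.mono_mem f g h (hg R hR)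
      corestrict_mem := fun f j hj hf R hR => R.corestrict_mem f j hj (hf R hR) }

/-- The complete lattice of pseudovarieties of relational morphisms. -/
instance : CompleteLattice PVRM.{u} :=
  completeLatticeOfInf PVRM.{u} fun _ =>
    ⟨fun R hR _ hf => hf R hR, fun _ hQ _ hf _ hR => hQ hR hf⟩

/-- The pseudovariety of relational morphisms generated by a class of relational morphisms. -/
def generate (X : Set FinRelMor.{u}) : PVRM.{u} := sInf {R | X ⊆ (R : Set FinRelMor.{u})}

end PVRM

/-! Projectivity of the three semigroups is a lifting of idempotents. Each generates an atom because
it embeds in every nontrivial member of its pseudovariety. Conversely, a generator of an atom is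
commutative or a band (`PV.comm_or_band_of_isAtom`). A projective commutative semigroup is again a
band, since a cover that counts factors modulo a number splits (`IsProjective.idempotent_of_comm`).
A nontrivial band contains one of the three, and minimality of the atom concludes. For `PVRM`,
everything below `(1_a)` is a division with domain in `(a)`. The domains of a nontrivial `R` form a
nontrivial pseudovariety, hence all of `(a)`, so `R` contains a division with domain `a`. By
projectivity it contains an injective homomorphism, and corestriction recovers `1_a`. -/

theorem exists_idempotent_of_mul_closed {A : Type*} [Semigroup A] [Finite A] (s : Set A)
    (hs : s.Nonempty) (hmul : ∀ x ∈ s, ∀ y ∈ s, x * y ∈ s) : ∃ e ∈ s, e * e = e := by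
  -- With the discrete topology, a finite semigroup falls under the Ellis–Numakura lemma.
  let : TopologicalSpace A := ⊥
  have : DiscreteTopology A := ⟨rfl⟩
  exact exists_idempotent_in_compact_subsemigroup (fun _ => continuous_of_discreteTopology) s hs
    s.toFinite.isCompact hmul

theorem exists_pow_idempotent {M : Type*} [Monoid M] [Finite M] (x : M) :
    ∃ n : ℕ, 0 < n ∧ IsIdempotentElem (x ^ n) := by
  obtain ⟨_, ⟨n, hn, rfl⟩, he⟩ := exists_idempotent_of_mul_closed {y : M | ∃ n, 0 < n ∧ x ^ n = y}
    ⟨x, 1, one_pos, pow_one x⟩ (by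
      rintro _ ⟨m, hm, rfl⟩ _ ⟨n, _, rfl⟩
      exact ⟨m + n, by omega, pow_add x m n⟩)
  exact ⟨n, hn, he⟩

theorem exists_uniform_pow_idempotent (M : Type*) [Monoid M] [Finite M] :
    ∃ n : ℕ, 0 < n ∧ ∀ x : M, IsIdempotentElem (x ^ n) := by
  classical
  have := Fintype.ofFinite M
  choose n hn he using exists_pow_idempotent (M := M)
  refine ⟨∏ x, n x, Finset.prod_pos fun x _ => hn x, fun x => ?_⟩
  obtain ⟨k, hk⟩ := Finset.dvd_prod_of_mem n (Finset.mem_univ x)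
  rw [hk, pow_mul]
  exact (he x).pow k

/-! ### Projectivity of the three two-element semigroups -/

namespace FinSgp

/-- A subsemigroup given by a nonempty multiplicatively closed set. -/
def ofSubsemigroup (S : FinSgp.{u}) (H : Subsemigroup S) (hH : (H : Set S).Nonempty) :
    FinSgp.{u} where
  carrier := H
  nonempty := hH.to_subtype

theorem exists_hom_twoRightZero {A : FinSgp.{u}} (x y : A) (hx : x * x = x) (hy : y * y = y)
    (hxy : x * y = y) (hyx : y * x = x) :
    ∃ j : twoRightZero.{u} →ₙ* A, j ⟨0⟩ = x ∧ j ⟨1⟩ = y := by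
  refine ⟨⟨fun i => if i.down = 0 then x else y, ?_⟩, rfl, rfl⟩
  rintro ⟨i⟩ ⟨j⟩
  change (if j = 0 then x else y) = (if i = 0 then x else y) * (if j = 0 then x else y)
  split_ifs <;> simp [*]

theorem exists_hom_twoLeftZero {A : FinSgp.{u}} (x y : A) (hx : x * x = x) (hy : y * y = y)
    (hxy : x * y = x) (hyx : y * x = y) :
    ∃ j : twoLeftZero.{u} →ₙ* A, j ⟨0⟩ = x ∧ j ⟨1⟩ = y := by
  refine ⟨⟨fun i => if i.down = 0 then x else y, ?_⟩, rfl, rfl⟩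
  rintro ⟨i⟩ ⟨j⟩
  change (if i = 0 then x else y) = (if i = 0 then x else y) * (if j = 0 then x else y)
  split_ifs <;> simp [*]

theorem exists_hom_zeroOne {A : FinSgp.{u}} (x y : A) (hx : x * x = x) (hy : y * y = y)
    (hxy : x * y = x) (hyx : y * x = x) :
    ∃ j : zeroOne.{u} →ₙ* A, j ⟨0⟩ = x ∧ j ⟨1⟩ = y := by
  refine ⟨⟨fun i => if i.down = 0 then x else y, ?_⟩, rfl, rfl⟩
  rintro ⟨i⟩ ⟨j⟩
  change (if i * j = 0 then x else y) = (if i = 0 then x else y) * (if j = 0 then x else y)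
  fin_cases i <;> fin_cases j <;> simp [*]

theorem injective_of_ne {A : Type*} {j : ULift.{u} (Fin 2) → A} (h : j ⟨0⟩ ≠ j ⟨1⟩) :
    Function.Injective j := by
  rintro ⟨a⟩ ⟨b⟩ hab
  fin_cases a <;> fin_cases b
  exacts [rfl, (h hab).elim, (h hab.symm).elim, rfl]

theorem isProjective_twoRightZero : IsProjective twoRightZero.{u} := by
  intro S φ hφ
  obtain ⟨x, hx⟩ := hφ ⟨0⟩
  obtain ⟨y, hy⟩ := hφ ⟨1⟩
  obtain ⟨e, he, hee⟩ := exists_idempotent_of_mul_closed {z : S | φ z = ⟨0⟩} ⟨x, hx⟩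
    (fun a _ b hb => (map_mul φ a b).trans hb)
  -- Choosing `f` in `eS` makes `f * e` and `f` a right zero pair; `f * e` still lies over `0`.
  obtain ⟨f, ⟨hf, hef⟩, hff⟩ := exists_idempotent_of_mul_closed {z : S | φ z = ⟨1⟩ ∧ e * z = z}
    ⟨e * y, (map_mul φ e y).trans hy, by rw [← mul_assoc, hee]⟩
    (fun a ha b hb => ⟨(map_mul φ a b).trans hb.1, by rw [← mul_assoc, ha.2]⟩)
  obtain ⟨ψ, h0, h1⟩ := exists_hom_twoRightZero (f * e) f
    (by rw [mul_assoc, ← mul_assoc e, hef, ← mul_assoc, hff]) hff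
    (by rw [mul_assoc, hef, hff]) (by rw [← mul_assoc, hff])
  refine ⟨ψ, ?_⟩
  rintro ⟨i⟩
  fin_cases i
  exacts [(congrArg φ h0).trans ((map_mul φ f e).trans he), (congrArg φ h1).trans hf]

theorem isProjective_twoLeftZero : IsProjective twoLeftZero.{u} := by
  intro S φ hφ
  obtain ⟨x, hx⟩ := hφ ⟨0⟩
  obtain ⟨y, hy⟩ := hφ ⟨1⟩
  obtain ⟨e, he, hee⟩ := exists_idempotent_of_mul_closed {z : S | φ z = ⟨0⟩} ⟨x, hx⟩
    (fun a ha b _ => (map_mul φ a b).trans ha)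
  obtain ⟨f, ⟨hf, hfe⟩, hff⟩ := exists_idempotent_of_mul_closed {z : S | φ z = ⟨1⟩ ∧ z * e = z}
    ⟨y * e, (map_mul φ y e).trans hy, by rw [mul_assoc, hee]⟩
    (fun a ha b hb => ⟨(map_mul φ a b).trans ha.1, by rw [mul_assoc, hb.2]⟩)
  obtain ⟨ψ, h0, h1⟩ := exists_hom_twoLeftZero (e * f) f
    (by rw [mul_assoc, ← mul_assoc f, hfe, hff]) hff
    (by rw [mul_assoc, hff]) (by rw [← mul_assoc, hfe, hff])
  refine ⟨ψ, ?_⟩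
  rintro ⟨i⟩
  fin_cases i
  exacts [(congrArg φ h0).trans ((map_mul φ e f).trans he), (congrArg φ h1).trans hf]

theorem isProjective_zeroOne : IsProjective zeroOne.{u} := by
  intro S φ hφ
  obtain ⟨o, i, h0, h1, hoo, hoi, hio, hii⟩ : ∃ o i : zeroOne.{u}, o = ⟨0⟩ ∧ i = ⟨1⟩ ∧
      o * o = o ∧ o * i = o ∧ i * o = o ∧ i * i = i :=
    ⟨⟨0⟩, ⟨1⟩, rfl, rfl, rfl, rfl, rfl, rfl⟩
  obtain ⟨x, hx⟩ := hφ o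
  obtain ⟨y, hy⟩ := hφ i
  obtain ⟨e, he : φ e = i, hee⟩ := exists_idempotent_of_mul_closed {z : S | φ z = i} ⟨y, hy⟩
    (fun a (ha : φ a = i) b (hb : φ b = i) => show φ (a * b) = i by rw [map_mul, ha, hb, hii])
  -- The idempotent over `0` is sought inside `eSe`, so that it lies below `e`.
  obtain ⟨f, ⟨hf, hef, hfe⟩, hff⟩ := exists_idempotent_of_mul_closed
    {z : S | φ z = o ∧ e * z = z ∧ z * e = z}
    ⟨e * x * e, by rw [map_mul, map_mul, he, hx, hio, hoi],
      by rw [← mul_assoc, ← mul_assoc, hee], by rw [mul_assoc, hee]⟩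
    (fun a ha b hb => ⟨by rw [map_mul, ha.1, hb.1, hoo], by rw [← mul_assoc, ha.2.1],
      by rw [mul_assoc, hb.2.2]⟩)
  obtain ⟨ψ, hψ0, hψ1⟩ := exists_hom_zeroOne f e hff hee hfe hef
  refine ⟨ψ, ?_⟩
  rintro ⟨k⟩
  fin_cases k
  exacts [(congrArg φ hψ0).trans (hf.trans h0), (congrArg φ hψ1).trans (he.trans h1)]

/-! ### Projective commutative semigroups and small subsemigroups of bands -/

/-- The cover used to separate a commutative semigroup from its idempotents: pairs `(f, s)` such
that `s` is a product in which each `x` occurs `f x` times modulo `m`. -/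
def countCover (A : Type u) [CommSemigroup A] [Fintype A] (m : ℕ) :
    Subsemigroup (Multiplicative (A → ZMod m) × A) where
  carrier := {p | ∃ n : A → ℕ, (p.2 : WithOne A) = ∏ x : A, (x : WithOne A) ^ n x ∧
    p.1.toAdd = fun x => (n x : ZMod m)}
  mul_mem' := by
    rintro ⟨f, s⟩ ⟨g, t⟩ ⟨n, hs, hf⟩ ⟨k, ht, hg⟩
    refine ⟨n + k, ?_, ?_⟩
    · simp only [Prod.mk_mul_mk, WithOne.coe_mul, Pi.add_apply, pow_add, Finset.prod_mul_distrib]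
      exact congrArg₂ (· * ·) hs ht
    · funext x
      simp only [Prod.mk_mul_mk, toAdd_mul, Pi.add_apply, Nat.cast_add]
      exact congrArg₂ (· + ·) (congrFun hf x) (congrFun hg x)

/-- A section of `countCover` yields a homomorphism `count` to a group of exponent vectors. Its
values have order dividing `N`, which forces `x` to be a product of `N`-th powers, that is, of
commuting idempotents. -/
theorem IsProjective.idempotent_of_comm {a : FinSgp.{u}} (ha : a.IsProjective)
    (hc : ∀ x y : a, x * y = y * x) (x : a) : x * x = x := by
  classical
  let : CommSemigroup a := { a.semigroup with mul_comm := hc }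
  let := Fintype.ofFinite a
  have : Finite (WithOne a) := inferInstanceAs (Finite (Option a))
  obtain ⟨N, hN, hid⟩ := exists_uniform_pow_idempotent (WithOne a)
  -- Modulus `N * N`, not `N`: from `N * n y ≡ 0` it follows that `N ∣ n y`.
  have : NeZero (N * N) := ⟨(Nat.mul_pos hN hN).ne'⟩
  have hgen : ∀ y : a, (Multiplicative.ofAdd (fun z => ((if z = y then 1 else 0 : ℕ) :
      ZMod (N * N))), y) ∈ countCover a (N * N) := fun y =>
    ⟨fun z => if z = y then 1 else 0, by simp [Finset.prod_ite_eq', pow_ite], rfl⟩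
  let C : FinSgp.{u} :=
    { carrier := countCover a (N * N)
      finite := inferInstance
      nonempty := ⟨⟨_, hgen x⟩⟩ }
  let φ : C →ₙ* a := ⟨fun p => p.1.2, fun _ _ => rfl⟩
  obtain ⟨ψ, hψ⟩ := ha C φ fun y => ⟨⟨_, hgen y⟩, rfl⟩
  let count : a →ₙ* Multiplicative (a → ZMod (N * N)) :=
    ⟨fun y => (ψ y).1.1, fun y z => by rw [map_mul]; rfl⟩
  obtain ⟨n, hx, hn⟩ := (ψ x).2
  have hx' : (x : WithOne a) = ∏ y : a, (y : WithOne a) ^ n y := by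
    rw [← hx]; exact congrArg _ (hψ x).symm
  -- `x ^ N` is idempotent, and the only idempotent of a group is `1`.
  have hcount : count x ^ N = 1 := by
    have h := (hid x).map (WithOne.lift count)
    rw [map_pow, WithOne.lift_coe] at h
    exact mul_eq_left.1 h
  have hdvd : ∀ y, N ∣ n y := by
    intro y
    have h3 := congrFun (congrArg Multiplicative.toAdd hcount) y
    have h4 : (count x).toAdd = fun y => (n y : ZMod (N * N)) := hn
    rw [toAdd_pow, h4] at h3
    simp only [toAdd_one, Pi.zero_apply, Pi.smul_apply, nsmul_eq_mul] at h3
    rw [← Nat.cast_mul, ZMod.natCast_eq_zero_iff] at h3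
    exact Nat.dvd_of_mul_dvd_mul_left hN h3
  apply WithOne.coe_injective
  rw [WithOne.coe_mul, hx', ← Finset.prod_mul_distrib]
  refine Finset.prod_congr rfl fun y _ => ?_
  obtain ⟨k, hk⟩ := hdvd y
  rw [hk, pow_mul]
  exact (hid y).pow k

/-- A nontrivial band contains a two-element right zero semigroup, left zero semigroup or
semilattice. -/
theorem exists_embedding_of_band {A : FinSgp.{u}} [Nontrivial A] (hA : ∀ x : A, x * x = x) :
    (∃ j : twoRightZero.{u} →ₙ* A, Function.Injective j) ∨
      (∃ j : twoLeftZero.{u} →ₙ* A, Function.Injective j) ∨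
      ∃ j : zeroOne.{u} →ₙ* A, Function.Injective j := by
  by_cases h : ∃ x y : A, x ≠ y ∧ x * y = x ∧ y * x = x
  · obtain ⟨x, y, hne, hxy, hyx⟩ := h
    obtain ⟨j, h0, h1⟩ := exists_hom_zeroOne x y (hA x) (hA y) hxy hyx
    exact Or.inr (Or.inr ⟨j, injective_of_ne (by rwa [h0, h1])⟩)
  -- `x * y * x` lies below `x` in the idempotent order, so without a two-element semilattice the
  -- band is rectangular.
  have hrect : ∀ x y : A, x * y * x = x := by
    intro x y
    by_contra hne
    exact h ⟨x * y * x, x, hne, by rw [mul_assoc, hA], by rw [← mul_assoc, ← mul_assoc, hA]⟩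
  obtain ⟨s, t, hst⟩ := exists_pair_ne A
  by_cases hs : s = s * t
  · obtain ⟨j, h0, h1⟩ := exists_hom_twoLeftZero s t (hA s) (hA t) hs.symm
      (by rw [hs, ← mul_assoc, hrect])
    exact Or.inr (Or.inl ⟨j, injective_of_ne (by rwa [h0, h1])⟩)
  · obtain ⟨j, h0, h1⟩ := exists_hom_twoRightZero s (s * t) (hA s) (hA _)
      (by rw [← mul_assoc, hA]) (hrect s t)
    exact Or.inl ⟨j, injective_of_ne (by rwa [h0, h1])⟩

end FinSgp

/-! ### Atoms of the lattice of pseudovarieties -/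

namespace PV

theorem mem_generate_self (a : FinSgp.{u}) : a ∈ generate {a} :=
  fun _ hV => hV rfl

theorem generate_le {a : FinSgp.{u}} {V : PV.{u}} (h : a ∈ V) : generate {a} ≤ V :=
  fun _ hS => hS V (Set.singleton_subset_iff.2 h)

/-- The pseudovariety of trivial semigroups. -/
def trivials : PV.{u} where
  carrier := {S | Subsingleton S}
  trivial_mem := inferInstanceAs (Subsingleton PUnit)
  prod_mem := fun S T (_ : Subsingleton S) (_ : Subsingleton T) =>
    inferInstanceAs (Subsingleton (S × T))
  sub_mem := fun _ _ _ hj (_ : Subsingleton _) => hj.subsingleton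
  quot_mem := fun _ _ _ hp (_ : Subsingleton _) => hp.subsingleton

theorem eq_bot_iff_subsingleton {V : PV.{u}} : V = ⊥ ↔ ∀ S ∈ V, Subsingleton S := by
  constructor
  · rintro rfl S hS
    exact (bot_le : ⊥ ≤ trivials) hS
  · intro h
    refine eq_bot_iff.2 fun S hS => ?_
    have := h S hS
    exact (⊥ : PV.{u}).sub_mem S FinSgp.trivial ⟨fun _ => PUnit.unit, fun _ _ => rfl⟩
      (fun _ _ _ => Subsingleton.elim _ _) (⊥ : PV.{u}).trivial_mem

theorem ne_bot_of_nontrivial {V : PV.{u}} {S : FinSgp.{u}} (hS : S ∈ V) [hn : Nontrivial S] :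
    V ≠ ⊥ := fun h =>
  not_subsingleton_iff_nontrivial.2 hn (eq_bot_iff_subsingleton.1 h S hS)

theorem exists_nontrivial_of_ne_bot {V : PV.{u}} (hV : V ≠ ⊥) : ∃ S ∈ V, Nontrivial S := by
  by_contra! h
  exact hV (eq_bot_iff_subsingleton.2 fun S hS => h S hS)

/-- The pseudovariety of right zero semigroups. -/
def rightZero : PV.{u} where
  carrier := {S | ∀ x y : S, x * y = y}
  trivial_mem := fun _ _ => rfl
  prod_mem := fun _ _ hS hT x y => Prod.ext (hS x.1 y.1) (hT x.2 y.2)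
  sub_mem := fun _ _ j hj hT x y => hj (by rw [map_mul, hT])
  quot_mem := fun _ _ p hp hS x y => by
    obtain ⟨x, rfl⟩ := hp x
    obtain ⟨y, rfl⟩ := hp y
    rw [← map_mul, hS]

/-- The pseudovariety of left zero semigroups. -/
def leftZero : PV.{u} where
  carrier := {S | ∀ x y : S, x * y = x}
  trivial_mem := fun _ _ => rfl
  prod_mem := fun _ _ hS hT x y => Prod.ext (hS x.1 y.1) (hT x.2 y.2)
  sub_mem := fun _ _ j hj hT x y => hj (by rw [map_mul, hT])
  quot_mem := fun _ _ p hp hS x y => by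
    obtain ⟨x, rfl⟩ := hp x
    obtain ⟨y, rfl⟩ := hp y
    rw [← map_mul, hS]

/-- The pseudovariety of commutative semigroups. -/
def commutative : PV.{u} where
  carrier := {S | ∀ x y : S, x * y = y * x}
  trivial_mem := fun _ _ => rfl
  prod_mem := fun _ _ hS hT x y => Prod.ext (hS x.1 y.1) (hT x.2 y.2)
  sub_mem := fun _ _ j hj hT x y => hj (by rw [map_mul, hT, map_mul])
  quot_mem := fun _ _ p hp hS x y => by
    obtain ⟨x, rfl⟩ := hp x
    obtain ⟨y, rfl⟩ := hp y
    rw [← map_mul, hS, map_mul]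

/-- The pseudovariety of bands. -/
def band : PV.{u} where
  carrier := {S | ∀ x : S, x * x = x}
  trivial_mem := fun _ => rfl
  prod_mem := fun _ _ hS hT x => Prod.ext (hS x.1) (hT x.2)
  sub_mem := fun _ _ j hj hT x => hj (by rw [map_mul, hT])
  quot_mem := fun _ _ p hp hS x => by
    obtain ⟨x, rfl⟩ := hp x
    rw [← map_mul, hS]

theorem isAtom_generate {a : FinSgp.{u}} [Nontrivial a]
    (h : ∀ S ∈ generate {a}, Nontrivial S → ∃ j : a →ₙ* S, Function.Injective j) :
    IsAtom (generate {a}) := by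
  refine ⟨ne_bot_of_nontrivial (mem_generate_self a), fun V hV => ?_⟩
  by_contra hne
  obtain ⟨S, hS, hn⟩ := exists_nontrivial_of_ne_bot hne
  obtain ⟨j, hj⟩ := h S (hV.le hS) hn
  exact hV.not_ge (generate_le (V.sub_mem _ _ j hj hS))

theorem isAtom_twoRightZero : IsAtom (generate {FinSgp.twoRightZero.{u}}) := by
  have : Nontrivial FinSgp.twoRightZero.{u} := inferInstanceAs (Nontrivial (ULift (Fin 2)))
  refine isAtom_generate fun S hS _ => ?_
  have hS' : ∀ x y : S, x * y = y :=
    (generate_le (show FinSgp.twoRightZero ∈ rightZero from fun _ _ => rfl)) hS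
  obtain ⟨x, y, hxy⟩ := exists_pair_ne S
  obtain ⟨j, h0, h1⟩ := FinSgp.exists_hom_twoRightZero x y (hS' _ _) (hS' _ _) (hS' _ _) (hS' _ _)
  exact ⟨j, FinSgp.injective_of_ne (by rwa [h0, h1])⟩

theorem isAtom_twoLeftZero : IsAtom (generate {FinSgp.twoLeftZero.{u}}) := by
  have : Nontrivial FinSgp.twoLeftZero.{u} := inferInstanceAs (Nontrivial (ULift (Fin 2)))
  refine isAtom_generate fun S hS _ => ?_
  have hS' : ∀ x y : S, x * y = x :=
    (generate_le (show FinSgp.twoLeftZero ∈ leftZero from fun _ _ => rfl)) hS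
  obtain ⟨x, y, hxy⟩ := exists_pair_ne S
  obtain ⟨j, h0, h1⟩ := FinSgp.exists_hom_twoLeftZero x y (hS' _ _) (hS' _ _) (hS' _ _) (hS' _ _)
  exact ⟨j, FinSgp.injective_of_ne (by rwa [h0, h1])⟩

theorem isAtom_zeroOne : IsAtom (generate {FinSgp.zeroOne.{u}}) := by
  have : Nontrivial FinSgp.zeroOne.{u} := inferInstanceAs (Nontrivial (ULift (Fin 2)))
  refine isAtom_generate fun S hS _ => ?_
  have hc : ∀ x y : S, x * y = y * x :=
    (generate_le (show FinSgp.zeroOne ∈ commutative from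
      fun x y => congrArg ULift.up (mul_comm x.down y.down))) hS
  have hb : ∀ x : S, x * x = x :=
    (generate_le (show FinSgp.zeroOne ∈ band from by
      rintro ⟨i⟩
      fin_cases i <;> rfl)) hS
  -- In a semilattice `x * y` lies below `y`, so these two form a copy of `{0, 1}` once distinct.
  have key : ∀ x y : S, x * y ≠ y → ∃ j : FinSgp.zeroOne →ₙ* S, Function.Injective j := by
    intro x y hne
    obtain ⟨j, h0, h1⟩ := FinSgp.exists_hom_zeroOne (x * y) y (hb _) (hb _)
      (by rw [mul_assoc, hb]) (by rw [hc, mul_assoc, hb])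
    exact ⟨j, FinSgp.injective_of_ne (by rwa [h0, h1])⟩
  obtain ⟨x, y, hxy⟩ := exists_pair_ne S
  by_cases h : x * y = y
  · exact key y x (by rw [hc, h]; exact hxy.symm)
  · exact key x y h

theorem generate_eq_of_isAtom {a b : FinSgp.{u}} (ha : IsAtom (generate {a}))
    (hb : b ∈ generate {a}) [Nontrivial b] : generate {a} = generate {b} :=
  ((ha.le_iff.1 (generate_le hb)).resolve_left
    (ne_bot_of_nontrivial (mem_generate_self b))).symm

/-- A finite semigroup that generates an atom is commutative or a band. -/
theorem comm_or_band_of_isAtom {a : FinSgp.{u}} (ha : IsAtom (generate {a})) :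
    (∀ x y : a, x * y = y * x) ∨ ∀ x : a, x * x = x := by
  by_contra! h
  obtain ⟨⟨y, z, hyz⟩, x, hx⟩ := h
  -- The monogenic subsemigroup of a non-idempotent is nontrivial and commutative; by minimality it
  -- generates all of `(a)`.
  let H : Subsemigroup a := Subsemigroup.closure {x}
  have hxH : x ∈ H := Subsemigroup.subset_closure rfl
  let b := a.ofSubsemigroup H ⟨x, hxH⟩
  have : Nontrivial b := ⟨⟨⟨x * x, H.mul_mem hxH hxH⟩, ⟨x, hxH⟩, fun h => hx (congrArg Subtype.val h)⟩⟩
  have hb : b ∈ generate {a} := (generate {a}).sub_mem b a ⟨Subtype.val, fun _ _ => rfl⟩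
    Subtype.val_injective (mem_generate_self a)
  have hcomm : b ∈ commutative :=
    (Subsemigroup.isMulCommutative_closure a (s := {x}) (by
      rintro _ rfl _ rfl
      rfl)).is_comm.comm
  have hac : a ∈ commutative := by
    refine generate_le hcomm ?_
    rw [← generate_eq_of_isAtom ha hb]
    exact mem_generate_self a
  exact hyz (hac y z)

theorem classification {a : FinSgp.{u}} (hp : a.IsProjective) (ha : IsAtom (generate {a})) :
    generate {a} = generate {FinSgp.twoRightZero} ∨
      generate {a} = generate {FinSgp.twoLeftZero} ∨
      generate {a} = generate {FinSgp.zeroOne} := by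
  have hband : ∀ x : a, x * x = x :=
    (comm_or_band_of_isAtom ha).elim (fun h => hp.idempotent_of_comm h) _root_.id
  have : Nontrivial a := by
    rw [← not_subsingleton_iff_nontrivial]
    intro h
    exact ha.1 (le_bot_iff.1 ((generate_le (show a ∈ trivials from h)).trans
      (eq_bot_iff_subsingleton.2 fun _ hS => hS).le))
  have : Nontrivial FinSgp.twoRightZero.{u} := inferInstanceAs (Nontrivial (ULift (Fin 2)))
  have : Nontrivial FinSgp.twoLeftZero.{u} := inferInstanceAs (Nontrivial (ULift (Fin 2)))
  have : Nontrivial FinSgp.zeroOne.{u} := inferInstanceAs (Nontrivial (ULift (Fin 2)))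
  have key : ∀ (b : FinSgp.{u}) [Nontrivial b], (∃ j : b →ₙ* a, Function.Injective j) →
      generate {a} = generate {b} := fun b _ ⟨j, hj⟩ =>
    generate_eq_of_isAtom ha ((generate {a}).sub_mem b a j hj (mem_generate_self a))
  exact (FinSgp.exists_embedding_of_band hband).imp (key _) (Or.imp (key _) (key _))

end PV

/-! ### Graphs of relational morphisms and divisions -/

namespace RelMor

theorem isDivision_ofHom {S T : FinSgp.{u}} {φ : S →ₙ* T} (h : Function.Injective φ) :
    (ofHom φ).IsDivision := fun _ _ _ h₁ h₂ => h (h₁.symm.trans h₂)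

/-- The inverse relation of a surjective homomorphism. -/
def invHom {S T : FinSgp.{u}} (p : S →ₙ* T) (hp : Function.Surjective p) : RelMor T S where
  rel t := {s | p s = t}
  nonempty' := hp
  mul_mem' := by
    rintro _ _ s₁ s₂ rfl rfl
    exact map_mul p s₁ s₂

theorem isDivision_invHom {S T : FinSgp.{u}} (p : S →ₙ* T) (hp : Function.Surjective p) :
    (invHom p hp).IsDivision := fun _ _ _ h₁ h₂ => h₁.symm.trans h₂

/-- The graph of a relational morphism, a subsemigroup of the product. -/
def graph {S T : FinSgp.{u}} (f : RelMor S T) : Subsemigroup (S × T) where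
  carrier := {p | p.2 ∈ f.rel p.1}
  mul_mem' := fun h₁ h₂ => f.mul_mem' _ _ _ _ h₁ h₂

theorem graph_nonempty {S T : FinSgp.{u}} (f : RelMor S T) :
    (f.graph : Set (S × T)).Nonempty := by
  obtain ⟨s⟩ := S.nonempty
  obtain ⟨t, ht⟩ := f.nonempty' s
  exact ⟨(s, t), ht⟩

/-- The graph of a relational morphism as a finite semigroup. -/
def graphSgp {S T : FinSgp.{u}} (f : RelMor S T) : FinSgp.{u} :=
  (S.prod T).ofSubsemigroup f.graph f.graph_nonempty

/-- The projection of the graph to the domain. -/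
def graphFst {S T : FinSgp.{u}} (f : RelMor S T) : f.graphSgp →ₙ* S :=
  ⟨fun p => p.1.1, fun _ _ => rfl⟩

/-- The projection of the graph to the codomain. -/
def graphSnd {S T : FinSgp.{u}} (f : RelMor S T) : f.graphSgp →ₙ* T :=
  ⟨fun p => p.1.2, fun _ _ => rfl⟩

theorem graphFst_surjective {S T : FinSgp.{u}} (f : RelMor S T) :
    Function.Surjective f.graphFst := fun s => by
  obtain ⟨t, ht⟩ := f.nonempty' s
  exact ⟨⟨(s, t), ht⟩, rfl⟩

theorem IsDivision.graphSnd_injective {S T : FinSgp.{u}} {d : RelMor S T} (hd : d.IsDivision) :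
    Function.Injective d.graphSnd := by
  rintro ⟨⟨s, t⟩, h⟩ ⟨⟨s', t'⟩, h'⟩ (rfl : t = t')
  exact Subtype.ext (Prod.ext (hd s s' t h h') rfl)

/-- The graph of `d` maps onto `S` and, `d` being a division, embeds in `T`. -/
theorem IsDivision.mem {S T : FinSgp.{u}} {d : RelMor S T} (hd : d.IsDivision) {V : PV.{u}}
    (hT : T ∈ V) : S ∈ V :=
  V.quot_mem _ _ d.graphFst d.graphFst_surjective
    (V.sub_mem _ _ d.graphSnd hd.graphSnd_injective hT)

/-- A relational morphism with projective domain contains a homomorphism. -/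
theorem exists_hom_of_isProjective {S T : FinSgp.{u}} (hS : S.IsProjective) (f : RelMor S T) :
    ∃ ψ : S →ₙ* T, ∀ s, ψ s ∈ f.rel s := by
  obtain ⟨σ, hσ⟩ := hS _ f.graphFst f.graphFst_surjective
  refine ⟨f.graphSnd.comp σ, fun s => ?_⟩
  have h : (σ s).1.2 ∈ f.rel (σ s).1.1 := (σ s).2
  have h' : (σ s).1.1 = s := hσ s
  rwa [h'] at h

end RelMor

/-! ### Atoms of the lattice of pseudovarieties of relational morphisms -/

namespace PVRM

theorem mem_generate_self (f : FinRelMor.{u}) : f ∈ generate {f} :=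
  fun _ hR => hR rfl

theorem generate_le {f : FinRelMor.{u}} {R : PVRM.{u}} (h : f ∈ R) : generate {f} ≤ R :=
  fun _ hg => hg R (Set.singleton_subset_iff.2 h)

/-- The divisions whose domain lies in a given pseudovariety. -/
def divisions (V : PV.{u}) : PVRM.{u} where
  carrier := {f | f.1 ∈ V ∧ f.2.2.IsDivision}
  id_trivial_mem := ⟨V.trivial_mem, fun _ _ _ _ _ => rfl⟩
  prod_mem := fun _ _ hf hg => ⟨V.prod_mem _ _ hf.1 hg.1, fun _ _ _ h h' =>
    Prod.ext (hf.2 _ _ _ h.1 h'.1) (hg.2 _ _ _ h.2 h'.2)⟩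
  div_comp_mem := fun _ _ hd hf => ⟨hd.mem hf.1, by
    rintro s s' x ⟨t, ht, hx⟩ ⟨t', ht', hx'⟩
    obtain rfl := hf.2 _ _ _ hx hx'
    exact hd _ _ _ ht ht'⟩
  comp_div_mem := fun _ _ hd hf => ⟨hf.1, by
    rintro s s' x ⟨t, ht, hx⟩ ⟨t', ht', hx'⟩
    obtain rfl := hd _ _ _ hx hx'
    exact hf.2 _ _ _ ht ht'⟩
  mono_mem := fun _ _ h hg => ⟨hg.1, fun _ _ _ h₁ h₂ => hg.2 _ _ _ (h _ h₁) (h _ h₂)⟩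
  corestrict_mem := fun _ j _ hf => ⟨hf.1, fun s s' t h h' =>
    hf.2 s s' (j t) ⟨t, h, rfl⟩ ⟨t, h', rfl⟩⟩

/-- The pseudovariety of domains of the members of `R`. -/
def domains (R : PVRM.{u}) : PV.{u} where
  carrier := {S | ∃ (T : FinSgp.{u}) (f : RelMor S T), f.bundle ∈ R}
  trivial_mem := ⟨_, _, R.id_trivial_mem⟩
  prod_mem := by
    rintro S T ⟨_, f, hf⟩ ⟨_, g, hg⟩
    exact ⟨_, _, R.prod_mem f g hf hg⟩
  sub_mem := by
    rintro S T j hj ⟨_, f, hf⟩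
    exact ⟨_, _, R.div_comp_mem _ f (RelMor.isDivision_ofHom hj) hf⟩
  quot_mem := by
    rintro S T p hp ⟨_, f, hf⟩
    exact ⟨_, _, R.div_comp_mem _ f (RelMor.isDivision_invHom p hp) hf⟩

/-- A member with one-element domain factors through the trivial semigroup, and any relational
morphism out of a one-element semigroup is a division. -/
theorem eq_bot_of_domains_eq_bot {R : PVRM.{u}} (h : R.domains = ⊥) : R = ⊥ := by
  refine eq_bot_iff.2 ?_
  rintro ⟨S, T, f⟩ hf
  have : Subsingleton S := PV.eq_bot_iff_subsingleton.1 h S ⟨T, f, hf⟩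
  let c : RelMor S FinSgp.trivial := RelMor.ofHom ⟨fun _ => PUnit.unit, fun _ _ => rfl⟩
  have hc : (c.comp (RelMor.id FinSgp.trivial)).bundle ∈ (⊥ : PVRM.{u}) :=
    (⊥ : PVRM.{u}).div_comp_mem c _ (fun _ _ _ _ _ => Subsingleton.elim _ _)
      (⊥ : PVRM.{u}).id_trivial_mem
  let d : RelMor FinSgp.trivial T :=
    { rel := fun _ => {t | ∃ s, t ∈ f.rel s}
      nonempty' := fun _ => by
        obtain ⟨s⟩ := S.nonempty
        obtain ⟨t, ht⟩ := f.nonempty' s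
        exact ⟨t, s, ht⟩
      mul_mem' := by
        rintro _ _ t₁ t₂ ⟨s₁, h₁⟩ ⟨s₂, h₂⟩
        exact ⟨s₁ * s₂, f.mul_mem' _ _ _ _ h₁ h₂⟩ }
  exact (⊥ : PVRM.{u}).mono_mem f ((c.comp (RelMor.id FinSgp.trivial)).comp d)
    (fun s t ht => ⟨PUnit.unit, ⟨PUnit.unit, rfl, rfl⟩, s, ht⟩)
    ((⊥ : PVRM.{u}).comp_div_mem _ d (fun _ _ _ _ _ => rfl) hc)

theorem isAtom_generate_id {a : FinSgp.{u}} (hp : a.IsProjective)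
    (ha : IsAtom (PV.generate {a})) : IsAtom (generate {(RelMor.id a).bundle}) := by
  have hle : generate {(RelMor.id a).bundle} ≤ divisions (PV.generate {a}) :=
    generate_le ⟨PV.mem_generate_self a, RelMor.isDivision_ofHom Function.injective_id⟩
  constructor
  · intro hbot
    have hmem : (RelMor.id a).bundle ∈ divisions ⊥ :=
      (hbot.le.trans bot_le) (mem_generate_self _)
    exact ha.1 (le_bot_iff.1 (PV.generate_le hmem.1))
  · intro R hR
    by_contra hne
    have hdom : R.domains ≤ PV.generate {a} := by
      rintro S ⟨T, f, hf⟩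
      exact (hle (hR.le hf)).1
    have heq : R.domains = PV.generate {a} :=
      (ha.le_iff.1 hdom).resolve_left fun h => hne (eq_bot_of_domains_eq_bot h)
    obtain ⟨T, f, hf⟩ : a ∈ R.domains := heq ▸ PV.mem_generate_self a
    have hdiv : f.IsDivision := (hle (hR.le hf)).2
    obtain ⟨ψ, hψ⟩ := f.exists_hom_of_isProjective hp
    have hinj : Function.Injective ψ := fun x y hxy =>
      hdiv x y (ψ x) (hψ x) (hxy ▸ hψ y)
    -- `1_a` followed by `ψ` is contained in `f`, hence lies in `R`; corestricting along the
    -- injective `ψ` leaves `1_a`.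
    refine hR.not_ge (generate_le (R.corestrict_mem (RelMor.id a) ψ hinj
      (R.mono_mem _ f ?_ hf)))
    rintro _ _ ⟨_, rfl, rfl⟩
    exact hψ _

end PVRM

theorem mainTheorem10 :
    (∀ a : FinSgp.{u},
      a = FinSgp.twoRightZero ∨ a = FinSgp.twoLeftZero ∨ a = FinSgp.zeroOne →
        a.IsProjective ∧ IsAtom (PV.generate {a}) ∧
          IsAtom (PVRM.generate {(RelMor.id a).bundle})) ∧
    (∀ a : FinSgp.{u}, a.IsProjective → IsAtom (PV.generate {a}) →
      (PV.generate {a} = PV.generate {FinSgp.twoRightZero} ∨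
        PV.generate {a} = PV.generate {FinSgp.twoLeftZero} ∨
        PV.generate {a} = PV.generate {FinSgp.zeroOne}) ∧
      IsAtom (PVRM.generate {(RelMor.id a).bundle})) := by
  refine ⟨fun a h => ?_, fun a hp ha => ⟨PV.classification hp ha, PVRM.isAtom_generate_id hp ha⟩⟩
  suffices h' : a.IsProjective ∧ IsAtom (PV.generate {a}) from
    ⟨h'.1, h'.2, PVRM.isAtom_generate_id h'.1 h'.2⟩
  rcases h with rfl | rfl | rfl
  exacts [⟨FinSgp.isProjective_twoRightZero, PV.isAtom_twoRightZero⟩,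
    ⟨FinSgp.isProjective_twoLeftZero, PV.isAtom_twoLeftZero⟩,
    ⟨FinSgp.isProjective_zeroOne, PV.isAtom_zeroOne⟩]
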